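/- Let $(X,d)$ be a (pseudo)metric space with a $\sigma$-algebra, let $\rho\ge 0$, $B_\rho(x)=\{z: d(x,z)\le\rho\}$, and let $\mathcal C,\mathcal H\subseteq\{0,1\}^X$. Write $\ell_\rho(c,h)(x)=\mathbf 1[\exists z\in B_\rho(x):\ c(z)\ne h(z)]$ for the robust loss, $\mathsf R^D_\rho(h,c)=\Pr_{x\sim D}[\ell_\rho(c,h)(x)=1]$ for the robust risk, $\mathcal L_\rho(\mathcal C,\mathcal H)=\{\ell_\rho(c,h):c\in\mathcal C,\,h\in\mathcal H\}$ and $\mathcal L_\rho(\mathcal C)=\mathcal L_\rho(\mathcal C,\mathcal C)$. $\mathsf{VC}$ and $\mathsf{Lit}$ denote the Vapnik–Chervonenkis and the Littlestone dimension. A (deterministic) learner receives $m$ i.i.d. examples $(x_i,c(x_i))$, $x_i\sim D$, and may adaptively query the $\rho$-local equivalence oracle ($\rho$-$\mathsf{LEQ}$) with pairs $(h,x_i)$; the oracle confirms that $h=c$ on $B_\rho(x_i)$ or returns some $z\in B_\rho(x_i)$ with $h(z)\neq c(z)$, chosen arbitrarily and possibly adaptively. The learner is *robustly consistent* for $\mathcal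 C$ with outputs in $\mathcal H$ if, for every target $c\in\mathcal C$ and every sample, it always halts with an output $h\in\mathcal H$ with $\ell_\rho(c,h)(x_i)=0$ for all $i$. It *distribution-free $\rho$-robustly learns* $\mathcal C$ with sample complexity $m_0$ if for all $0<\epsilon,\delta<1/2$, all distributions $D$ on $X$, all $c\in\mathcal C$ and all $m\ge m_0(\epsilon,\delta)$ it halts and, with probability at least $1-\delta$ over the sample, outputs $h$ with $\mathsf R_\rho^D(h,c)\le\epsilon$ for every valid behaviour of the oracle. It has query complexity $r$ if it never makes more than $r(m)$ queries on a sample of size $m$ labelled by some $c\in\mathcal C$. Below, whenever a bound with $\mathsf{VC}(\mathcal L_\rho(\mathcal C,\mathcal H))$ is claimed, this dimension is assumed finite and $(\mathcal C,\mathcal H)$ is assumed to satisfy the usual measurability condition: the losses $\ell_\rho(c,h)$, and for all $c\in\mathcal C$ and $m,k\in\mathbb N$ the sets of pairs $(S,S')\in X^m\times X^m$ for which some $h\in\mathcal H$ has robust loss $0$ on all points of $S$ and robust loss $1$ on at least $k$ points of $S'$, are measurable up to null sets for every $D$ (resp. for the product distributions $D^m\times D^m$). For the bounds with $\log|\mathcal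 H|$ only the losses themselves need be so measurable. **Theorem.** There is a universal constant $\kappa>0$ such that, for all such $X,\rho,\mathcal C$, with $$m_{\mathrm{VC}}(\mathcal H)=\frac{\kappa}{\epsilon}\Big(\mathsf{VC}(\mathcal L_\rho(\mathcal C,\mathcal H))\log\frac1\epsilon+\log\frac1\delta\Big),\qquad m_{\mathrm{fin}}(\mathcal H)=\frac1\epsilon\Big(\log|\mathcal H|+\log\frac1\delta\Big),$$ the following hold. 1. Every robustly consistent learner for $\mathcal C$ with outputs in $\mathcal H$ distribution-free $\rho$-robustly learns $\mathcal C$ with sample complexity $m_{\mathrm{VC}}(\mathcal H)$ and, if $\mathcal H$ is finite, also with sample complexity $m_{\mathrm{fin}}(\mathcal H)$. 2. (Standard Optimal Algorithm.) Consider the learner that queries the current hypothesis of the Standard Optimal Algorithm (SOA) for $\mathcal C$, with any tie-breaking, at the sample points one after another, feeds each counterexample to the SOA and starts over, until the hypothesis has been confirmed at all sample points or $\mathsf{Lit}(\mathcal C)$ counterexamples have been received, and finally outputs, without further queries, a concept of $\mathcal C$ that coincides with the final hypothesis on the balls $B_\rho(x_i)$. If $\mathsf{Lit}(\mathcal C)<\infty$,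 it is robustly consistent with outputs in $\mathcal C$, makes at most $m\cdot\mathsf{Lit}(\mathcal C)$ queries, and distribution-free $\rho$-robustly learns $\mathcal C$ with sample complexity $m_{\mathrm{VC}}(\mathcal C)$. If $\mathcal C$ is finite, it has the same properties with sample complexity $m_{\mathrm{fin}}(\mathcal C)$. If instead the final hypothesis of the SOA itself is output, and $\mathsf{Lit}(\mathcal C)<\infty$, then for every $\mathcal H$ that contains the hypotheses of the SOA (on data consistent with a concept of $\mathcal C$) the learner is robustly consistent with outputs in $\mathcal H$, makes at most $m\cdot\mathsf{Lit}(\mathcal C)$ queries, and has sample complexity $m_{\mathrm{VC}}(\mathcal H)$, and $m_{\mathrm{fin}}(\mathcal H)$ if $\mathcal H$ is finite. 3. (Online learners.) Let $A$ be any deterministic online learner that makes at most $M$ mistakes on every sequence consistent with a concept of $\mathcal C$, and whose hypotheses on data consistent with a concept of $\mathcal C$ belong to $\mathcal H$. Run $A$ in the same way (stopping after at most $M$ counterexamples). With the final hypothesis of $A$ as output, the learner is robustly consistent with outputs in $\mathcal H$, makes at most $m\cdot M$ queries, and distribution-free $\rho$-robustly learns $\mathcal C$ with sample complexity $m_{\mathrm{VC}}(\mathcal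 H)$, and $m_{\mathrm{fin}}(\mathcal H)$ if $\mathcal H$ is finite. With a concept of $\mathcal C$ that coincides with the final hypothesis on the balls $B_\rho(x_i)$ as output, the same holds with $\mathcal C$ in place of $\mathcal H$. -/

import Mathlib

open MeasureTheory

noncomputable section

namespace RobustLEQ

/-! ### The exact-in-the-ball robust loss

Concepts and hypotheses are functions `X → Bool`; a `{0,1}`-valued loss is identified with the
set of points at which it equals one. -/

/-- The robust loss `ℓ_ρ(c,h) : x ↦ 1[∃ z ∈ B_ρ(x), c z ≠ h z]`, as a set of points. -/
def robustLoss {X : Type*} [PseudoMetricSpace X] (ρ : ℝ) (c h : X → Bool) : Set X :=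
  {x | ∃ z ∈ Metric.closedBall x ρ, c z ≠ h z}

/-- The class `L_ρ(C,H)` of robust losses between a target in `C` and a hypothesis in `H`. -/
def lossClass {X : Type*} [PseudoMetricSpace X] (ρ : ℝ) (C H : Set (X → Bool)) : Set (Set X) :=
  {E | ∃ c ∈ C, ∃ h ∈ H, E = robustLoss ρ c h}

/-- The exact-in-the-ball robust risk `R_ρ^D(h,c)`. -/
def robustRisk {X : Type*} [PseudoMetricSpace X] [MeasurableSpace X] (ρ : ℝ) (D : Measure X)
    (c h : X → Bool) : ENNReal :=
  D (robustLoss ρ c h)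

/-! ### Vapnik-Chervonenkis dimension -/

/-- `F` realizes all the dichotomies of the finite set `A`. -/
def Shatters {X : Type*} (F : Set (Set X)) (A : Finset X) : Prop :=
  ∀ T : Set X, ∃ E ∈ F, ∀ x ∈ A, x ∈ E ↔ x ∈ T

/-- The largest size of a shattered set (`⊤` if there is no largest one). -/
def vcDim {X : Type*} (F : Set (Set X)) : ℕ∞ :=
  ⨆ (A : Finset X) (_ : Shatters F A), (A.card : ℕ∞)

/-! ### Littlestone dimension -/

/-- Complete binary trees of depth `d` whose internal nodes are points of `X`; the first subtree
hangs below the edge labelled `false`, the second one below the edge labelled `true`. -/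
inductive LTree (X : Type*) : ℕ → Type _
  | leaf : LTree X 0
  | node {d : ℕ} : X → LTree X d → LTree X d → LTree X (d + 1)

/-- The root-to-leaf paths of a tree, as lists of labelled points. -/
def LTree.paths {X : Type*} : {d : ℕ} → LTree X d → Set (List (X × Bool))
  | _, .leaf => {[]}
  | _, .node x t₀ t₁ =>
      {p | (∃ q ∈ t₀.paths, p = (x, false) :: q) ∨ (∃ q ∈ t₁.paths, p = (x, true) :: q)}

/-- `h` agrees with all the labelled points of the list `E`. -/
def Agrees {X : Type*} (h : X → Bool) (E : List (X × Bool)) : Prop :=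
  ∀ p ∈ E, h p.1 = p.2

/-- Littlestone trees for `H`: every path from the root to a leaf is consistent with some
member of `H`. -/
def IsLittlestoneTree {X : Type*} (H : Set (X → Bool)) {d : ℕ} (t : LTree X d) : Prop :=
  ∀ p ∈ t.paths, ∃ h ∈ H, Agrees h p

/-- The Littlestone dimension: the largest depth of a Littlestone tree (`⊤` if unbounded). -/
def litDim {X : Type*} (H : Set (X → Bool)) : ℕ∞ :=
  ⨆ (d : ℕ) (_ : ∃ t : LTree X d, IsLittlestoneTree H t), (d : ℕ∞)

open Classical in
/-- The Littlestone dimension with the usual convention that the empty class lies strictly below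
every nonempty class. -/
def litRank {X : Type*} (H : Set (X → Bool)) : WithBot ℕ∞ :=
  if H = ∅ then ⊥ else ((litDim H : ℕ∞) : WithBot ℕ∞)

/-! ### Online learning in the mistake-bound model -/

/-- An online learner: from the labelled examples seen so far, in chronological order, it computes
its current hypothesis. -/
abbrev OnlineLearner (X : Type*) := List (X × Bool) → X → Bool

/-- The number of mistakes of `A` on the sequence `s`, when the examples in `E` came before. -/
def mistakes {X : Type*} (A : OnlineLearner X) : List (X × Bool) → List (X × Bool) → ℕ
  | _, [] => 0
  | E, p :: s => (if A E p.1 ≠ p.2 then 1 else 0) + mistakes A (E ++ [p]) s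

/-- `A` makes at most `M` mistakes on any sequence consistent with a concept of `C`. -/
def HasMistakeBound {X : Type*} (A : OnlineLearner X) (C : Set (X → Bool)) (M : ℕ) : Prop :=
  ∀ c ∈ C, ∀ s : List (X × Bool), Agrees c s → mistakes A [] s ≤ M

/-- On data consistent with a concept of `C`, the hypotheses of `A` belong to `H`. -/
def UsesHypotheses {X : Type*} (A : OnlineLearner X) (C H : Set (X → Bool)) : Prop :=
  ∀ E : List (X × Bool), (∃ c ∈ C, Agrees c E) → A E ∈ H

/-- The concepts of `C` consistent with the labelled points in `E`. -/
def versionSpace {X : Type*} (C : Set (X → Bool)) (E : List (X × Bool)) : Set (X → Bool) :=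
  {h | h ∈ C ∧ Agrees h E}

/-- `A` is the Standard Optimal Algorithm for `C` (with some way of breaking ties): at every
point it predicts a label whose version space has maximal Littlestone dimension. -/
def IsSOA {X : Type*} (C : Set (X → Bool)) (A : OnlineLearner X) : Prop :=
  ∀ (E : List (X × Bool)) (x : X) (b : Bool),
    litRank (versionSpace C (E ++ [(x, b)])) ≤ litRank (versionSpace C (E ++ [(x, A E x)]))

/-! ### Learning with random examples and local equivalence queries -/

/-- A learner holding a sample of size `m` either sends a hypothesis and the index of a sample
point to the local equivalence oracle, or stops and outputs a hypothesis. -/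
inductive LEQAction (X : Type*) (m : ℕ) : Type _
  | query : (X → Bool) → Fin m → LEQAction X m
  | output : (X → Bool) → LEQAction X m

/-- A learner: from a labelled sample and the list of the oracle's answers so far, it computes its
next action. An answer is `none` (the hypothesis is confirmed) or `some z` (a counterexample). -/
abbrev LEQLearner (X : Type*) :=
  (m : ℕ) → (Fin m → X × Bool) → List (Option X) → LEQAction X m

/-- The correct answers of the `ρ`-local equivalence oracle for the target `c` to a query `(h,x)`:
the confirmation if `h` and `c` coincide on `B_ρ(x)`, and otherwise any point of `B_ρ(x)` at which
they differ. -/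
def ValidAnswer {X : Type*} [PseudoMetricSpace X] (ρ : ℝ) (c : X → Bool) (x : X) (h : X → Bool) :
    Option X → Prop
  | none => ∀ z ∈ Metric.closedBall x ρ, h z = c z
  | some z => z ∈ Metric.closedBall x ρ ∧ h z ≠ c z

/-- The random examples of `EX(c,D)`: sample points with their labels. -/
def labelled {X : Type*} {m : ℕ} (c : X → Bool) (x : Fin m → X) : Fin m → X × Bool :=
  fun i => (x i, c (x i))

/-- The answer sequences that can occur when `L` runs on the sample points `x` labelled by `c`,
for some (possibly adaptive) way of choosing counterexamples. Its length is the number of queries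
made. -/
inductive Reachable {X : Type*} [PseudoMetricSpace X] (L : LEQLearner X) (ρ : ℝ) (c : X → Bool)
    {m : ℕ} (x : Fin m → X) : List (Option X) → Prop
  | nil : Reachable L ρ c x []
  | snoc (s : List (Option X)) (h : X → Bool) (i : Fin m) (a : Option X) :
      Reachable L ρ c x s → L m (labelled c x) s = LEQAction.query h i →
      ValidAnswer ρ c (x i) h a → Reachable L ρ c x (s ++ [a])

/-- `L`, run on `x` labelled by `c`, may stop with output `h`. -/
def MayOutput {X : Type*} [PseudoMetricSpace X] (L : LEQLearner X) (ρ : ℝ) (c : X → Bool)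
    {m : ℕ} (x : Fin m → X) (h : X → Bool) : Prop :=
  ∃ s, Reachable L ρ c x s ∧ L m (labelled c x) s = LEQAction.output h

/-- `L` stops after finitely many queries, whatever counterexamples the oracle chooses. -/
def Halts {X : Type*} [PseudoMetricSpace X] (L : LEQLearner X) (ρ : ℝ) (c : X → Bool)
    {m : ℕ} (x : Fin m → X) : Prop :=
  ¬ ∃ a : ℕ → Option X, ∀ n : ℕ, Reachable L ρ c x ((List.range n).map a)

/-- With a sample of size `m`, `L` makes at most `r m` queries, for every target in `C`. -/
def QueryBound {X : Type*} [PseudoMetricSpace X] (L : LEQLearner X) (ρ : ℝ)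
    (C : Set (X → Bool)) (r : ℕ → ℕ∞) : Prop :=
  ∀ c ∈ C, ∀ (m : ℕ) (x : Fin m → X) (s : List (Option X)),
    Reachable L ρ c x s → (s.length : ℕ∞) ≤ r m

/-- `L` always stops, and outputs a hypothesis in `H` that has robust loss zero on every sample
point. -/
def RobustlyConsistent {X : Type*} [PseudoMetricSpace X] (L : LEQLearner X) (ρ : ℝ)
    (C H : Set (X → Bool)) : Prop :=
  ∀ c ∈ C, ∀ (m : ℕ) (x : Fin m → X), Halts L ρ c x ∧
    ∀ h, MayOutput L ρ c x h → h ∈ H ∧ ∀ i, x i ∉ robustLoss ρ c h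

/-- `L` is a distribution-free `ρ`-robust learner for `C` with sample complexity `m₀`. The set of
bad samples is measured by the outer measure of `D^m`, and a sample is bad as soon as some valid
behaviour of the oracle leads to an output of robust risk larger than `ε`. -/
def RobustlyLearns {X : Type*} [PseudoMetricSpace X] [MeasurableSpace X] (L : LEQLearner X)
    (ρ : ℝ) (C : Set (X → Bool)) (m₀ : ℝ → ℝ → ℝ) : Prop :=
  ∀ ε δ : ℝ, 0 < ε → ε < 1 / 2 → 0 < δ → δ < 1 / 2 →
    ∀ (D : Measure X) [IsProbabilityMeasure D], ∀ c ∈ C, ∀ m : ℕ, m₀ ε δ ≤ m →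
      (∀ x : Fin m → X, Halts L ρ c x) ∧
      Measure.pi (fun _ : Fin m => D)
        {x | ∃ h, MayOutput L ρ c x h ∧ ENNReal.ofReal ε < robustRisk ρ D c h}
        ≤ ENNReal.ofReal δ

/-! ### The learner obtained from an online learner -/

/-- One step of the bookkeeping: the labelled counterexamples received so far, and the number of
sample points at which the current hypothesis has been confirmed. -/
def step {X : Type*} (A : OnlineLearner X) (st : List (X × Bool) × ℕ) :
    Option X → List (X × Bool) × ℕ
  | none => (st.1, st.2 + 1)
  | some z => (st.1 ++ [(z, !(A st.1 z))], 0)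

/-- The learner that queries the current hypothesis of `A` at the sample points one after another,
feeds each counterexample to `A` and then starts over with the new hypothesis. It stops when its
hypothesis has been confirmed at all sample points, or after `M` counterexamples, and then applies
the map `out` (which may use the sample points) to the final hypothesis. -/
def onlineLEQ {X : Type*} (A : OnlineLearner X) (M : ℕ)
    (out : (m : ℕ) → (Fin m → X) → (X → Bool) → X → Bool) : LEQLearner X :=
  fun m S answers =>
    let st := answers.foldl (step A) ([], 0)
    if hi : st.2 < m ∧ st.1.length < M then LEQAction.query (A st.1) ⟨st.2, hi.1⟩
    else LEQAction.output (out m (fun i => (S i).1) (A st.1))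

/-- Output the final hypothesis itself. -/
def plainOutput {X : Type*} (m : ℕ) (_x : Fin m → X) (h : X → Bool) : X → Bool := h

open Classical in
/-- Output a concept of `C` that coincides with the final hypothesis on the `ρ`-balls around the
sample points (this costs no query). -/
def properOutput {X : Type*} [PseudoMetricSpace X] (ρ : ℝ) (C : Set (X → Bool))
    (m : ℕ) (x : Fin m → X) (h : X → Bool) : X → Bool :=
  if hg : ∃ g ∈ C, ∀ i, x i ∉ robustLoss ρ h g then Classical.choose hg else h

/-! ### Measurability and sample sizes -/

/-- All the robust losses between `C` and `H` are universally measurable, so that the robust risk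
is a probability. -/
def MeasurableLosses {X : Type*} [PseudoMetricSpace X] [MeasurableSpace X] (ρ : ℝ)
    (C H : Set (X → Bool)) : Prop :=
  ∀ c ∈ C, ∀ h ∈ H, ∀ (D : Measure X) [IsProbabilityMeasure D],
    NullMeasurableSet (robustLoss ρ c h) D

/-- The usual measurability condition behind the double sampling argument: the robust losses, and
the events "some `h ∈ H` has robust loss zero on the first sample and robust loss one at no fewer
than `k` points of the second sample", are universally measurable. It holds automatically on
countable spaces with measurable points. -/
def WellBehaved {X : Type*} [PseudoMetricSpace X] [MeasurableSpace X] (ρ : ℝ)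
    (C H : Set (X → Bool)) : Prop :=
  MeasurableLosses ρ C H ∧
  ∀ c ∈ C, ∀ (D : Measure X) [IsProbabilityMeasure D], ∀ m k : ℕ,
    NullMeasurableSet
      {p : (Fin m → X) × (Fin m → X) | ∃ h ∈ H, (∀ i, p.1 i ∉ robustLoss ρ c h) ∧
        k ≤ {i | p.2 i ∈ robustLoss ρ c h}.ncard}
      ((Measure.pi fun _ : Fin m => D).prod (Measure.pi fun _ : Fin m => D))

/-- `(κ/ε) (d log(1/ε) + log(1/δ))` for a VC dimension `d`. -/
def vcSampleSize (κ : ℝ) (d : ℕ) (ε δ : ℝ) : ℝ :=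
  κ / ε * (d * Real.log (1 / ε) + Real.log (1 / δ))

/-- `(1/ε) (log N + log(1/δ))` for a class of `N` functions. -/
def finiteSampleSize (N : ℕ) (ε δ : ℝ) : ℝ :=
  1 / ε * (Real.log N + Real.log (1 / δ))

end RobustLEQ

end

namespace RobustLEQ

/-! ### Online learners as learners with local equivalence queries -/

section Online

variable {X : Type*}

/-! The argument has two independent halves. The combinatorial half: every counterexample is a
point, labelled by the target, on which the online learner has just erred, so the mistake bound
limits the number of rounds, and a round costs at most `m` queries. When the run stops, either the
hypothesis has been confirmed on every ball, or the mistakes are used up and it can differ from the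
target nowhere (`onlineLEQ_invariant`, `HasMistakeBound.mayOutput`). For the SOA the mistakes can be
glued into a Littlestone tree, so `litDim` is a mistake bound (`IsSOA.exists_tree`).

The probabilistic half concerns only the loss sets `robustLoss ρ c h`: an output with zero loss on
the sample is a set of the class that misses every sample point. For finite classes a union bound
over the sets of measure above `ε` suffices. For finite VC dimension the proof is the classical
double sampling: symmetrize with a ghost sample, swap the two samples coordinatewise, and count the
traces of the class on `2 * m` points by Sauer-Shelah (`measure_exists_le_two_mul`,
`measure_doubleSampleEvent_le`). The choices of the learner and of the oracle disappear, since the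
bound is uniform over all consistent hypotheses. -/

theorem mistakes_append (A : OnlineLearner X) (s : List (X × Bool)) :
    ∀ E t : List (X × Bool), mistakes A E (s ++ t) = mistakes A E s + mistakes A (E ++ s) t := by
  induction s with
  | nil => intro E t; simp [mistakes]
  | cons p s ih => intro E t; simp [mistakes, ih, add_assoc]

theorem agrees_append {h : X → Bool} {E F : List (X × Bool)} :
    Agrees h (E ++ F) ↔ Agrees h E ∧ Agrees h F := by
  simp only [Agrees, List.mem_append, or_imp, forall_and]

theorem agrees_singleton {h : X → Bool} {x : X} {b : Bool} :
    Agrees h [(x, b)] ↔ h x = b := by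
  simp [Agrees]

variable [PseudoMetricSpace X]

/-- The invariant of a run of `onlineLEQ`: all the data are counterexamples labelled by the
target, and the current hypothesis has been confirmed at the first `st.2` sample points. -/
theorem onlineLEQ_invariant {A : OnlineLearner X} {M : ℕ}
    {out : (m : ℕ) → (Fin m → X) → (X → Bool) → X → Bool} {ρ : ℝ} {c : X → Bool}
    {m : ℕ} {x : Fin m → X} {s : List (Option X)}
    (hs : Reachable (onlineLEQ A M out) ρ c x s) :
    let st := s.foldl (step A) ([], 0)
    Agrees c st.1 ∧ mistakes A [] st.1 = st.1.length ∧ st.1.length ≤ M ∧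
      s.length ≤ m * st.1.length + st.2 ∧ st.2 ≤ m ∧ (st.1.length = M → st.2 = 0) ∧
      ∀ i : Fin m, (i : ℕ) < st.2 → ∀ z ∈ Metric.closedBall (x i) ρ, A st.1 z = c z := by
  induction hs with
  | nil => simp [Agrees, mistakes]
  | snoc s h i a _ hq ha ih =>
    simp only [onlineLEQ] at hq
    simp only [List.foldl_append, List.foldl_cons, List.foldl_nil]
    obtain ⟨h1, h2, h3, h4, h5, h6, h7⟩ := ih
    split_ifs at hq with hi
    injection hq with hh hii
    subst hh
    replace hii := congrArg Fin.val hii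
    simp only at hii
    generalize s.foldl (step A) ([], 0) = st at *
    cases a with
    | none =>
      refine ⟨h1, h2, h3, ?_, ?_, ?_, ?_⟩
      · simp only [step, List.length_append, List.length_singleton]; omega
      · exact hi.1
      · intro h; simp only [step] at h; omega
      · intro j hj z hz
        rcases Nat.lt_succ_iff_lt_or_eq.mp hj with hj | hj
        · exact h7 j hj z hz
        · have : j = i := Fin.ext (hj.trans hii)
          subst this
          exact ha z hz
    | some z =>
      obtain ⟨hz, hne⟩ := ha
      have hc : (!(A st.1 z)) = c z := by
        cases hA : A st.1 z <;> cases hcz : c z <;> simp_all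
      refine ⟨?_, ?_, ?_, ?_, ?_, ?_, ?_⟩
      · exact agrees_append.2 ⟨h1, agrees_singleton.2 hc.symm⟩
      · simp [step, mistakes_append, h2, mistakes]
      · simp only [step, List.length_append, List.length_singleton]; omega
      -- The round ending here had fewer than `m` confirmations, so with the counterexample it used
      -- at most `m` queries.
      · simp only [step, List.length_append, List.length_singleton, mul_add]; omega
      · simp [step]
      · simp [step]
      · intro j hj; simp [step] at hj

/-- Each counterexample pays for at most `m` queries. An unfinished last round is charged to one
further counterexample; this is affordable because no confirmation is requested after the `M`-th
one. The cap is built into the learner, so no mistake bound is needed. -/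
theorem queryBound_onlineLEQ {A : OnlineLearner X} {M : ℕ} {ρ : ℝ} {C : Set (X → Bool)}
    {out : (m : ℕ) → (Fin m → X) → (X → Bool) → X → Bool} :
    QueryBound (onlineLEQ A M out) ρ C (fun m => m * M) := by
  intro c _ m x s hs
  obtain ⟨_, _, h3, h4, h5, h6, _⟩ := onlineLEQ_invariant hs
  have : s.length ≤ m * M := by
    rcases h3.eq_or_lt with h | h
    · rw [h6 h, h] at h4; simpa using h4
    · calc s.length ≤ _ := h4
        _ ≤ m * ((s.foldl (step A) ([], 0)).1.length + 1) := by rw [mul_add]; omega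
        _ ≤ m * M := Nat.mul_le_mul_left _ h
  beta_reduce
  exact_mod_cast this

theorem halts_onlineLEQ {A : OnlineLearner X} {M : ℕ} {ρ : ℝ} {c : X → Bool}
    {out : (m : ℕ) → (Fin m → X) → (X → Bool) → X → Bool} {m : ℕ} (x : Fin m → X) :
    Halts (onlineLEQ A M out) ρ c x := by
  rintro ⟨a, ha⟩
  have h := queryBound_onlineLEQ (C := {c}) c rfl m x _ (ha (m * M + 1))
  have h' : m * M + 1 ≤ m * M := by
    simp only [List.length_map, List.length_range] at h
    exact_mod_cast h
  omega

/-- Whatever the oracle does, `onlineLEQ` stops with a hypothesis of `A` on data consistent with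
the target, which coincides with the target on all the balls. -/
theorem HasMistakeBound.mayOutput {A : OnlineLearner X} {M : ℕ} {ρ : ℝ} {C : Set (X → Bool)}
    (hA : HasMistakeBound A C M) {out : (m : ℕ) → (Fin m → X) → (X → Bool) → X → Bool}
    {c : X → Bool} (hc : c ∈ C) {m : ℕ} {x : Fin m → X} {h : X → Bool}
    (hh : MayOutput (onlineLEQ A M out) ρ c x h) :
    ∃ E, Agrees c E ∧ h = out m x (A E) ∧
      ∀ i, ∀ z ∈ Metric.closedBall (x i) ρ, A E z = c z := by
  obtain ⟨s, hs, ho⟩ := hh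
  obtain ⟨h1, h2, h3, h4, h5, h6, h7⟩ := onlineLEQ_invariant hs
  simp only [onlineLEQ] at ho
  split_ifs at ho with hi
  injection ho with ho
  simp only [labelled] at ho
  generalize s.foldl (step A) ([], 0) = st at *
  refine ⟨st.1, h1, ho.symm, fun i z hz => ?_⟩
  -- After `M` counterexamples a disagreement at any point would be mistake number `M + 1` on
  -- consistent data. With fewer counterexamples, the run can only have stopped because all `m`
  -- points were confirmed.
  by_cases hM : st.1.length = M
  · by_contra hne
    have := hA c hc (st.1 ++ [(z, c z)]) (agrees_append.2 ⟨h1, agrees_singleton.2 rfl⟩)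
    simp [mistakes_append, h2, mistakes, hne] at this
    omega
  · exact h7 i (by omega) z hz

theorem HasMistakeBound.robustlyConsistent_plainOutput {A : OnlineLearner X} {M : ℕ} {ρ : ℝ}
    {C H : Set (X → Bool)} (hA : HasMistakeBound A C M) (hH : UsesHypotheses A C H) :
    RobustlyConsistent (onlineLEQ A M plainOutput) ρ C H := by
  refine fun c hc m x => ⟨halts_onlineLEQ x, fun h hh => ?_⟩
  obtain ⟨E, hE, rfl, hb⟩ := hA.mayOutput hc hh
  refine ⟨hH E ⟨c, hc, hE⟩, ?_⟩
  rintro i ⟨z, hz, hne⟩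
  exact hne (hb i z hz).symm

/-- The target itself witnesses that `properOutput` has a concept to choose. The chosen concept and
the target both coincide with the final hypothesis on the balls, hence with each other. -/
theorem HasMistakeBound.robustlyConsistent_properOutput {A : OnlineLearner X} {M : ℕ} {ρ : ℝ}
    {C : Set (X → Bool)} (hA : HasMistakeBound A C M) :
    RobustlyConsistent (onlineLEQ A M (properOutput ρ C)) ρ C C := by
  refine fun c hc m x => ⟨halts_onlineLEQ x, fun h hh => ?_⟩
  obtain ⟨E, hE, rfl, hb⟩ := hA.mayOutput hc hh
  have hg : ∃ g ∈ C, ∀ i, x i ∉ robustLoss ρ (A E) g :=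
    ⟨c, hc, by rintro i ⟨z, hz, hne⟩; exact hne (hb i z hz)⟩
  rw [properOutput, dif_pos hg]
  obtain ⟨h1, h2⟩ := Classical.choose_spec hg
  refine ⟨h1, ?_⟩
  rintro i ⟨z, hz, hne⟩
  exact h2 i ⟨z, hz, by rwa [hb i z hz]⟩

end Online

/-! ### The Littlestone dimension and the Standard Optimal Algorithm -/

section Littlestone

variable {X : Type*}

theorem IsLittlestoneTree.mono {H K : Set (X → Bool)} (h : H ⊆ K) {d : ℕ} {t : LTree X d}
    (ht : IsLittlestoneTree H t) : IsLittlestoneTree K t := fun p hp =>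
  let ⟨g, hg, ha⟩ := ht p hp
  ⟨g, h hg, ha⟩

theorem isLittlestoneTree_leaf {H : Set (X → Bool)} :
    IsLittlestoneTree H (LTree.leaf : LTree X 0) ↔ H.Nonempty := by
  simp [IsLittlestoneTree, LTree.paths, Agrees, Set.Nonempty]

theorem isLittlestoneTree_node {H : Set (X → Bool)} {d : ℕ} {x : X} {t₀ t₁ : LTree X d} :
    IsLittlestoneTree H (LTree.node x t₀ t₁) ↔
      IsLittlestoneTree {h | h ∈ H ∧ h x = false} t₀ ∧
        IsLittlestoneTree {h | h ∈ H ∧ h x = true} t₁ := by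
  constructor
  · intro h
    constructor
    · intro q hq
      obtain ⟨g, hg, ha⟩ := h ((x, false) :: q) (Or.inl ⟨q, hq, rfl⟩)
      exact ⟨g, ⟨hg, ha (x, false) (by simp)⟩, fun p hp => ha p (by simp [hp])⟩
    · intro q hq
      obtain ⟨g, hg, ha⟩ := h ((x, true) :: q) (Or.inr ⟨q, hq, rfl⟩)
      exact ⟨g, ⟨hg, ha (x, true) (by simp)⟩, fun p hp => ha p (by simp [hp])⟩
  · rintro ⟨h0, h1⟩ p (⟨q, hq, rfl⟩ | ⟨q, hq, rfl⟩)
    · obtain ⟨g, ⟨hg, hx⟩, ha⟩ := h0 q hq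
      refine ⟨g, hg, fun p hp => ?_⟩
      rcases List.mem_cons.1 hp with rfl | hp
      exacts [hx, ha p hp]
    · obtain ⟨g, ⟨hg, hx⟩, ha⟩ := h1 q hq
      refine ⟨g, hg, fun p hp => ?_⟩
      rcases List.mem_cons.1 hp with rfl | hp
      exacts [hx, ha p hp]

/-- Every root-to-leaf path exists, so a class with a Littlestone tree is nonempty. -/
theorem IsLittlestoneTree.nonempty {d : ℕ} {t : LTree X d} :
    ∀ {H : Set (X → Bool)}, IsLittlestoneTree H t → H.Nonempty := by
  induction t with
  | leaf => exact isLittlestoneTree_leaf.1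
  | node x t₀ t₁ ih₀ _ =>
    intro H h
    obtain ⟨g, hg, _⟩ := ih₀ (isLittlestoneTree_node.1 h).1
    exact ⟨g, hg⟩

theorem exists_isLittlestoneTree_of_succ (d : ℕ) :
    ∀ (H : Set (X → Bool)), (∃ t : LTree X (d + 1), IsLittlestoneTree H t) →
      ∃ t : LTree X d, IsLittlestoneTree H t := by
  induction d with
  | zero => rintro H ⟨t, ht⟩; exact ⟨.leaf, isLittlestoneTree_leaf.2 ht.nonempty⟩
  | succ d ih =>
    rintro H ⟨t, ht⟩
    cases t with
    | node x t₀ t₁ =>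
      obtain ⟨h₀, h₁⟩ := isLittlestoneTree_node.1 ht
      obtain ⟨s₀, hs₀⟩ := ih _ ⟨_, h₀⟩
      obtain ⟨s₁, hs₁⟩ := ih _ ⟨_, h₁⟩
      exact ⟨.node x s₀ s₁, isLittlestoneTree_node.2 ⟨hs₀, hs₁⟩⟩

theorem exists_isLittlestoneTree_of_le {d e : ℕ} (hde : d ≤ e) (H : Set (X → Bool))
    (h : ∃ t : LTree X e, IsLittlestoneTree H t) : ∃ t : LTree X d, IsLittlestoneTree H t := by
  induction e, hde using Nat.le_induction with
  | base => exact h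
  | succ e _ ih => exact ih (exists_isLittlestoneTree_of_succ e H h)

theorem le_litDim {H : Set (X → Bool)} {d : ℕ} {t : LTree X d} (ht : IsLittlestoneTree H t) :
    (d : ℕ∞) ≤ litDim H :=
  le_iSup₂_of_le d ⟨t, ht⟩ le_rfl

/-- A supremum above `d` gives only some tree of depth greater than `d`, which is then truncated.
Nonemptiness matters at depth zero: `litDim ∅` is the empty supremum `0`, yet the empty class has
not even a leaf as a tree. -/
theorem exists_isLittlestoneTree_of_le_litDim {H : Set (X → Bool)} (hH : H.Nonempty) {d : ℕ}
    (hd : (d : ℕ∞) ≤ litDim H) : ∃ t : LTree X d, IsLittlestoneTree H t := by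
  cases d with
  | zero => exact ⟨.leaf, isLittlestoneTree_leaf.2 hH⟩
  | succ d =>
    have hlt : (d : ℕ∞) < litDim H := lt_of_lt_of_le (by exact_mod_cast Nat.lt_succ_self d) hd
    obtain ⟨e, he⟩ := lt_iSup_iff.1 hlt
    obtain ⟨ht, he⟩ := lt_iSup_iff.1 he
    exact exists_isLittlestoneTree_of_le (by exact_mod_cast he) H ht

/-- The value `⊥` at the empty class is what excludes `K = ∅` here. With `litDim` alone, the SOA
could prefer an empty version space to a nonempty one of dimension zero. -/
theorem exists_isLittlestoneTree_of_litRank_le {H K : Set (X → Bool)}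
    (hHK : litRank H ≤ litRank K) {d : ℕ} (h : ∃ t : LTree X d, IsLittlestoneTree H t) :
    ∃ t : LTree X d, IsLittlestoneTree K t := by
  obtain ⟨t, ht⟩ := h
  rw [litRank, if_neg ht.nonempty.ne_empty, litRank] at hHK
  split_ifs at hHK with hK
  · simp at hHK
  · exact exists_isLittlestoneTree_of_le_litDim (Set.nonempty_iff_ne_empty.2 hK)
      ((le_litDim ht).trans (WithBot.coe_le_coe.1 hHK))

theorem versionSpace_append_subset (C : Set (X → Bool)) (E : List (X × Bool)) (x : X) (b : Bool) :
    versionSpace C (E ++ [(x, b)]) ⊆ {h | h ∈ versionSpace C E ∧ h x = b} := by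
  rintro h ⟨hC, hE⟩
  obtain ⟨h1, h2⟩ := agrees_append.1 hE
  exact ⟨⟨hC, h1⟩, agrees_singleton.1 h2⟩

/-- The mistakes of the Standard Optimal Algorithm span a Littlestone tree. -/
theorem IsSOA.exists_tree {C : Set (X → Bool)} {A : OnlineLearner X} (hA : IsSOA C A)
    {c : X → Bool} (hc : c ∈ C) (s : List (X × Bool)) :
    ∀ E, Agrees c (E ++ s) →
      ∃ t : LTree X (mistakes A E s), IsLittlestoneTree (versionSpace C E) t := by
  induction s with
  | nil =>
    intro E hE
    exact ⟨.leaf, isLittlestoneTree_leaf.2 ⟨c, hc, by simpa using hE⟩⟩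
  | cons p s ih =>
    intro E hE
    obtain ⟨x, y⟩ := p
    obtain ⟨t, ht⟩ := ih (E ++ [(x, y)]) (by simpa using hE)
    by_cases hy : A E x = y
    · have : mistakes A E ((x, y) :: s) = mistakes A (E ++ [(x, y)]) s := by simp [mistakes, hy]
      rw [this]
      exact ⟨t, ht.mono fun h hh => (versionSpace_append_subset C E x y hh).1⟩
    · have : mistakes A E ((x, y) :: s) = mistakes A (E ++ [(x, y)]) s + 1 := by
        simp [mistakes, hy, add_comm]
      rw [this]
      -- On a mistake, the version space of the predicted, wrong label has at least the rank of the
      -- true one, so it carries a tree of the same depth. The two trees hang below `x` on opposite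
      -- edges, and the depth grows by one.
      obtain ⟨u, hu⟩ := exists_isLittlestoneTree_of_litRank_le (hA E x y) ⟨t, ht⟩
      replace ht := ht.mono (versionSpace_append_subset C E x y)
      replace hu := hu.mono (versionSpace_append_subset C E x _)
      cases y with
      | false =>
        rw [Bool.not_eq_false] at hy
        rw [hy] at hu
        exact ⟨.node x t u, isLittlestoneTree_node.2 ⟨ht, hu⟩⟩
      | true =>
        rw [Bool.not_eq_true] at hy
        rw [hy] at hu
        exact ⟨.node x u t, isLittlestoneTree_node.2 ⟨hu, ht⟩⟩

theorem IsSOA.hasMistakeBound {C : Set (X → Bool)} {A : OnlineLearner X} (hA : IsSOA C A)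
    (hC : litDim C ≠ ⊤) : HasMistakeBound A C (litDim C).toNat := by
  intro c hc s hs
  obtain ⟨t, ht⟩ := hA.exists_tree hc s [] (by simpa using hs)
  have := le_litDim (ht.mono (K := C) fun h hh => hh.1)
  rw [← ENat.natCast_toNat hC] at this
  exact_mod_cast this

/-- The label at the root splits the class into two disjoint parts that carry the subtrees. This
crude bound serves only to show that finite classes have finite `litDim`. -/
theorem IsLittlestoneTree.lt_ncard {d : ℕ} {t : LTree X d} :
    ∀ {H : Set (X → Bool)}, H.Finite → IsLittlestoneTree H t → d < H.ncard := by
  induction t with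
  | leaf => exact fun hH h => (Set.ncard_pos hH).2 h.nonempty
  | node x t₀ t₁ ih₀ ih₁ =>
    intro H hH h
    obtain ⟨h₀, h₁⟩ := isLittlestoneTree_node.1 h
    have hf₀ : {h | h ∈ H ∧ h x = false}.Finite := hH.subset fun h hh => hh.1
    have hf₁ : {h | h ∈ H ∧ h x = true}.Finite := hH.subset fun h hh => hh.1
    have hd : Disjoint {h | h ∈ H ∧ h x = false} {h | h ∈ H ∧ h x = true} := by
      rw [Set.disjoint_left]
      rintro h ⟨_, h0⟩ ⟨_, h1⟩
      simp [h0] at h1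
    have hle := Set.ncard_le_ncard (s := {h | h ∈ H ∧ h x = false} ∪ {h | h ∈ H ∧ h x = true})
      (t := H) (by rintro h (hh | hh) <;> exact hh.1) hH
    rw [Set.ncard_union_eq hd hf₀ hf₁] at hle
    have := ih₀ hf₀ h₀
    have := ih₁ hf₁ h₁
    omega

theorem litDim_ne_top_of_finite {C : Set (X → Bool)} (hC : C.Finite) : litDim C ≠ ⊤ := by
  have : litDim C ≤ (C.ncard : ℕ∞) := iSup₂_le fun d ⟨_, ht⟩ => by
    exact_mod_cast (ht.lt_ncard hC).le
  exact ne_top_of_le_ne_top (ENat.natCast_ne_top _) this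

theorem queryBound_onlineLEQ_litDim [PseudoMetricSpace X] {ρ : ℝ}
    {C : Set (X → Bool)} {A : OnlineLearner X}
    {out : (m : ℕ) → (Fin m → X) → (X → Bool) → X → Bool} (hC : litDim C ≠ ⊤) :
    QueryBound (onlineLEQ A (litDim C).toNat out) ρ C (fun m => m * litDim C) := by
  intro c hc m x s hs
  have h := queryBound_onlineLEQ c hc m x s hs
  beta_reduce at h ⊢
  rw [← ENat.natCast_toNat hC]
  exact_mod_cast h

end Littlestone

/-! ### Counting dichotomies and swaps -/

section Counting

/-- A smooth form of the Sauer-Shelah lemma. -/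
theorem card_le_of_shatters_card_le {α : Type*} [Fintype α] [DecidableEq α]
    (𝒜 : Finset (Finset α)) (d : ℕ) (hd : ∀ s, 𝒜.Shatters s → s.card ≤ d)
    {t : ℝ} (ht : 0 < t) (ht1 : t ≤ 1) :
    (𝒜.card : ℝ) ≤ (1 / t) ^ d * (1 + t) ^ Fintype.card α := by
  have h1 : (𝒜.card : ℝ) ≤ 𝒜.shatterer.card := by
    exact_mod_cast Finset.card_le_card_shatterer 𝒜
  -- A family has at most as many members as it has shattered sets. As these have size at most `d`,
  -- each has weight `t ^ (s.card - d) ≥ 1`; summing the weights over all subsets gives a binomial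
  -- expansion.
  have h2 : (𝒜.shatterer.card : ℝ) ≤ ∑ s ∈ 𝒜.shatterer, (1 / t) ^ d * t ^ s.card := by
    rw [Finset.card_eq_sum_ones]
    push_cast
    refine Finset.sum_le_sum fun s hs => ?_
    rw [one_div, inv_pow, ← div_eq_inv_mul, one_le_div (pow_pos ht d)]
    exact pow_le_pow_of_le_one ht.le ht1 (hd s (Finset.mem_shatterer.1 hs))
  have h3 : ∑ s ∈ 𝒜.shatterer, (1 / t) ^ d * t ^ s.card ≤
      ∑ s : Finset α, (1 / t) ^ d * t ^ s.card :=
    Finset.sum_le_sum_of_subset_of_nonneg (Finset.subset_univ _) fun _ _ _ => by positivity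
  have h4 : ∑ s : Finset α, t ^ s.card = (1 + t) ^ Fintype.card α := by
    rw [add_comm, ← Fintype.sum_pow_mul_eq_add_pow]
    simp
  rw [← Finset.mul_sum Finset.univ, h4] at h3
  linarith

/-- The swaps that move a given pattern off the first sample, at least `k` of its points being in
the second one. -/
theorem card_swaps_mul_two_pow_le {m : ℕ} (T : Finset (Fin m × Bool)) (k : ℕ) :
    (Finset.univ.filter fun σ : Fin m → Bool => (∀ i, (i, σ i) ∉ T) ∧
      k ≤ (Finset.univ.filter fun i => (i, !σ i) ∈ T).card).card * 2 ^ k ≤ 2 ^ m := by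
  set W := Finset.univ.filter fun σ : Fin m → Bool => (∀ i, (i, σ i) ∉ T) ∧
      k ≤ (Finset.univ.filter fun i => (i, !σ i) ∈ T).card
  rcases W.eq_empty_or_nonempty with h | ⟨τ, hτ⟩
  · simp [h]
  set J := Finset.univ.filter fun i => (i, !τ i) ∈ T
  obtain ⟨hτ1, hτ2⟩ := (Finset.mem_filter.1 hτ).2
  -- All admissible swaps agree with `τ` on `J`: flipping such a coordinate would put a point of `T`
  -- into the first sample. Only the coordinates outside `J` are free, and `J` has at least `k`
  -- elements.
  have hsub : W ⊆ Fintype.piFinset fun i => if i ∈ J then {τ i} else Finset.univ := by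
    intro σ hσ
    obtain ⟨hσ1, -⟩ := (Finset.mem_filter.1 hσ).2
    refine Fintype.mem_piFinset.2 fun i => ?_
    split_ifs with hi
    · have hJ : (i, !τ i) ∈ T := (Finset.mem_filter.1 hi).2
      have hne : σ i ≠ !τ i := fun h => hσ1 i (h ▸ hJ)
      rw [Finset.mem_singleton]
      cases hs : σ i <;> cases ht : τ i <;> simp_all
    · exact Finset.mem_univ _
  have hcard := Finset.card_le_card hsub
  have hprod : (Fintype.piFinset fun i => if i ∈ J then {τ i} else Finset.univ).card * 2 ^ J.card
      = 2 ^ m := by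
    rw [Fintype.card_piFinset]
    have h1 : ∀ i, (if i ∈ J then ({τ i} : Finset Bool) else Finset.univ).card =
        if i ∈ J then 1 else 2 := by
      intro i; split_ifs <;> simp
    have h2 : (2 : ℕ) ^ J.card = ∏ i, if i ∈ J then 2 else 1 := by
      rw [Finset.prod_ite_mem]; simp
    simp_rw [h1]
    rw [h2, ← Finset.prod_mul_distrib, Finset.prod_congr rfl (g := fun _ => 2)]
    · simp
    · intro i _; split_ifs <;> rfl
  calc W.card * 2 ^ k ≤ W.card * 2 ^ J.card :=
        Nat.mul_le_mul_left _ (Nat.pow_le_pow_right (by norm_num) hτ2)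
    _ ≤ _ := Nat.mul_le_mul_right _ hcard
    _ = 2 ^ m := hprod

variable {X : Type*}

theorem Shatters.card_le_vcDim_toNat {F : Set (Set X)} (hF : vcDim F ≠ ⊤) {A : Finset X}
    (hA : Shatters F A) : A.card ≤ (vcDim F).toNat := by
  have h : (A.card : ℕ∞) ≤ vcDim F := le_iSup₂_of_le A hA le_rfl
  rw [← ENat.natCast_toNat hF] at h
  exact_mod_cast h

/-- The exchange of two samples at the indices where `σ` is true. -/
def swapMap {m : ℕ} (σ : Fin m → Bool) (p : (Fin m → X) × (Fin m → X)) :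
    (Fin m → X) × (Fin m → X) :=
  (fun i => cond (σ i) (p.2 i) (p.1 i), fun i => cond (σ i) (p.1 i) (p.2 i))

/-- The double samples for which some member of `F` avoids the first sample and contains at least
`k` points of the second one. -/
def doubleSampleEvent (F : Set (Set X)) (m k : ℕ) : Set ((Fin m → X) × (Fin m → X)) :=
  {p | ∃ E ∈ F, (∀ i, p.1 i ∉ E) ∧ k ≤ {i | p.2 i ∈ E}.ncard}

open Classical in
-- For a fixed double sample, a set of `F` matters only through its trace on the `2 * m` indices.
-- There are few traces by Sauer-Shelah, and each is compatible with at most `2 ^ m / 2 ^ k` swaps.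
-- Traces are taken on indices rather than points, so that repeated sample points do no harm.
theorem card_swapMap_mem_le (F : Set (Set X)) (d : ℕ)
    (hd : ∀ A : Finset X, Shatters F A → A.card ≤ d) (m k : ℕ) (p : (Fin m → X) × (Fin m → X))
    {t : ℝ} (ht : 0 < t) (ht1 : t ≤ 1) :
    ((Finset.univ.filter fun σ => swapMap σ p ∈ doubleSampleEvent F m k).card : ℝ) * 2 ^ k ≤
      (1 / t) ^ d * (1 + t) ^ (2 * m) * 2 ^ m := by
  set f : Fin m × Bool → X := fun j => cond j.2 (p.2 j.1) (p.1 j.1) with hf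
  set 𝒜 : Finset (Finset (Fin m × Bool)) :=
    Finset.univ.filter fun T => ∃ E ∈ F, ∀ j, j ∈ T ↔ f j ∈ E
  have hA : (𝒜.card : ℝ) ≤ (1 / t) ^ d * (1 + t) ^ (2 * m) := by
    have := card_le_of_shatters_card_le 𝒜 d ?_ ht ht1
    · simpa [mul_comm m 2] using this
    intro s hs
    -- Two indices carrying the same point lie in the same traces, so a shattered index set cannot
    -- contain both.
    have hinj : Set.InjOn f s := by
      intro a ha b hb hab
      rw [Finset.mem_coe] at ha hb
      obtain ⟨u, hu, hsu⟩ := hs (Finset.singleton_subset_iff.2 ha)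
      obtain ⟨E, -, hE⟩ := (Finset.mem_filter.1 hu).2
      have hau : a ∈ s ∩ u := by rw [hsu]; exact Finset.mem_singleton_self a
      have hfa := (hE a).1 (Finset.mem_inter.1 hau).2
      rw [hab] at hfa
      have hbu : b ∈ u := (hE b).2 hfa
      have : b ∈ s ∩ u := Finset.mem_inter.2 ⟨hb, hbu⟩
      rw [hsu, Finset.mem_singleton] at this
      exact this.symm
    rw [← Finset.card_image_of_injOn hinj]
    refine hd _ fun T => ?_
    obtain ⟨u, hu, hsu⟩ := hs (Finset.filter_subset (fun j => f j ∈ T) s)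
    obtain ⟨E, hEF, hE⟩ := (Finset.mem_filter.1 hu).2
    refine ⟨E, hEF, fun x hx => ?_⟩
    obtain ⟨j, hj, rfl⟩ := Finset.mem_image.1 hx
    have h1 : j ∈ s ∩ u ↔ j ∈ s.filter fun j => f j ∈ T := by rw [hsu]
    simp only [Finset.mem_inter, Finset.mem_filter, hj, true_and] at h1
    rw [← hE j, h1]
  have hN : (Finset.univ.filter fun σ => swapMap σ p ∈ doubleSampleEvent F m k).card * 2 ^ k ≤
      𝒜.card * 2 ^ m := by
    have hsub : (Finset.univ.filter fun σ => swapMap σ p ∈ doubleSampleEvent F m k) ⊆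
        𝒜.biUnion fun T => Finset.univ.filter fun σ : Fin m → Bool => (∀ i, (i, σ i) ∉ T) ∧
          k ≤ (Finset.univ.filter fun i => (i, !σ i) ∈ T).card := by
      intro σ hσ
      obtain ⟨E, hE, h0, h1⟩ := (Finset.mem_filter.1 hσ).2
      refine Finset.mem_biUnion.2 ⟨Finset.univ.filter fun j => f j ∈ E, ?_, ?_⟩
      · exact Finset.mem_filter.2 ⟨Finset.mem_univ _, E, hE, by simp⟩
      · refine Finset.mem_filter.2 ⟨Finset.mem_univ _, fun i hi => h0 i ?_, h1.trans_eq ?_⟩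
        · simpa [hf, swapMap] using hi
        · rw [← Set.ncard_coe_finset]
          congr 1
          ext i
          cases hσi : σ i <;> simp [hf, swapMap, hσi]
    calc _ ≤ (∑ T ∈ 𝒜, (Finset.univ.filter fun σ : Fin m → Bool => (∀ i, (i, σ i) ∉ T) ∧
          k ≤ (Finset.univ.filter fun i => (i, !σ i) ∈ T).card).card) * 2 ^ k :=
          Nat.mul_le_mul_right _ ((Finset.card_le_card hsub).trans Finset.card_biUnion_le)
      _ = ∑ T ∈ 𝒜, (Finset.univ.filter fun σ : Fin m → Bool => (∀ i, (i, σ i) ∉ T) ∧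
          k ≤ (Finset.univ.filter fun i => (i, !σ i) ∈ T).card).card * 2 ^ k := Finset.sum_mul ..
      _ ≤ ∑ T ∈ 𝒜, 2 ^ m := Finset.sum_le_sum fun T _ => card_swaps_mul_two_pow_le T k
      _ = 𝒜.card * 2 ^ m := by simp
  calc ((Finset.univ.filter fun σ => swapMap σ p ∈ doubleSampleEvent F m k).card : ℝ) * 2 ^ k
      ≤ 𝒜.card * 2 ^ m := by exact_mod_cast hN
    _ ≤ _ := by gcongr

end Counting

/-! ### Double sampling -/

section DoubleSampling

variable {X : Type*} [MeasurableSpace X]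

/-- A double sample is also a list of `m` independent pairs, and `σ` exchanges the two entries of
some of them, which preserves `D.prod D`. -/
theorem measurePreserving_swapMap (D : Measure X) [IsProbabilityMeasure D] {m : ℕ}
    (σ : Fin m → Bool) :
    MeasurePreserving (swapMap σ)
      ((Measure.pi fun _ : Fin m => D).prod (Measure.pi fun _ : Fin m => D))
      ((Measure.pi fun _ : Fin m => D).prod (Measure.pi fun _ : Fin m => D)) := by
  have he := measurePreserving_arrowProdEquivProdArrow X X (Fin m) (fun _ => D) (fun _ => D)
  have hg : ∀ i, MeasurePreserving (cond (σ i) Prod.swap id : X × X → X × X)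
      (D.prod D) (D.prod D) := by
    intro i
    cases σ i
    · exact MeasurePreserving.id _
    · exact Measure.measurePreserving_swap
  have h := (he.comp (measurePreserving_pi (fun _ : Fin m => D.prod D) (fun _ => D.prod D) hg)).comp
    (MeasurePreserving.symm _ he)
  convert h using 1
  ext p i <;> cases hσ : σ i <;>
    simp [swapMap, hσ, MeasurableEquiv.arrowProdEquivProdArrow, Equiv.arrowProdEquivProdArrow]

/-- The double sampling event has small probability. -/
theorem measure_doubleSampleEvent_le (D : Measure X) [IsProbabilityMeasure D] (F : Set (Set X))
    (d : ℕ) (hd : ∀ A : Finset X, Shatters F A → A.card ≤ d) (m k : ℕ)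
    (hQ : NullMeasurableSet (doubleSampleEvent F m k)
      ((Measure.pi fun _ : Fin m => D).prod (Measure.pi fun _ : Fin m => D)))
    {t : ℝ} (ht : 0 < t) (ht1 : t ≤ 1) :
    ((Measure.pi fun _ : Fin m => D).prod (Measure.pi fun _ : Fin m => D))
      (doubleSampleEvent F m k) ≤ ENNReal.ofReal ((1 / t) ^ d * (1 + t) ^ (2 * m) / 2 ^ k) := by
  classical
  set P := (Measure.pi fun _ : Fin m => D).prod (Measure.pi fun _ : Fin m => D)
  set Q := doubleSampleEvent F m k
  have hσ : ∀ σ : Fin m → Bool, P (swapMap σ ⁻¹' Q) = P Q := fun σ =>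
    (measurePreserving_swapMap D σ).measure_preimage hQ
  have hnull : ∀ σ : Fin m → Bool, NullMeasurableSet (swapMap σ ⁻¹' Q) P := fun σ =>
    hQ.preimage (measurePreserving_swapMap D σ).quasiMeasurePreserving
  set R := (1 / t) ^ d * (1 + t) ^ (2 * m) / 2 ^ k with hR
  -- Averaging over the swaps: all `2 ^ m` preimages have the measure of `Q`, while pointwise the
  -- sum of their indicators is the number of swaps bounded in `card_swapMap_mem_le`.
  have hsum : (2 : ENNReal) ^ m * P Q ≤ 2 ^ m * ENNReal.ofReal R := by
    calc (2 : ENNReal) ^ m * P Q = ∑ σ : Fin m → Bool, P (swapMap σ ⁻¹' Q) := by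
          simp [hσ]
      _ = ∑ σ : Fin m → Bool, ∫⁻ p, (swapMap σ ⁻¹' Q).indicator (fun _ => (1 : ENNReal)) p ∂P := by
          exact Finset.sum_congr rfl fun σ _ => (lintegral_indicator_one₀ (hnull σ)).symm
      _ = ∫⁻ p, ∑ σ : Fin m → Bool, (swapMap σ ⁻¹' Q).indicator (fun _ => (1 : ENNReal)) p ∂P := by
          rw [lintegral_finsetSum']
          exact fun σ _ => (aemeasurable_indicator_const_iff 1).2 (hnull σ)
      _ ≤ ∫⁻ _, 2 ^ m * ENNReal.ofReal R ∂P := by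
          refine lintegral_mono fun p => ?_
          have h1 : ∑ σ : Fin m → Bool, (swapMap σ ⁻¹' Q).indicator (fun _ => (1 : ENNReal)) p =
              ((Finset.univ.filter fun σ => swapMap σ p ∈ Q).card : ENNReal) := by
            rw [Finset.card_filter]
            push_cast
            exact Finset.sum_congr rfl fun σ _ => by simp [Set.indicator_apply]
          rw [h1, ← ENNReal.ofReal_natCast,
            show (2 : ENNReal) ^ m = ENNReal.ofReal (2 ^ m) by
              rw [ENNReal.ofReal_pow (by norm_num)]; norm_num,
            ← ENNReal.ofReal_mul (by positivity)]
          refine ENNReal.ofReal_le_ofReal ?_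
          rw [hR, mul_div_assoc', le_div_iff₀ (by positivity)]
          exact (card_swapMap_mem_le F d hd m k p ht ht1).trans_eq (mul_comm _ _)
      _ = _ := by simp
  exact (ENNReal.mul_le_mul_iff_right (by simp) (by simp)).1 hsum

/-- A set of measure larger than `ε` contains about the expected number of points of a random
sample, with probability at least one half. -/
theorem half_le_measure_le_ncard (D : Measure X) [IsProbabilityMeasure D] {E : Set X}
    (hE : NullMeasurableSet E D) {ε : ℝ} (hDE : ENNReal.ofReal ε < D E) {m k : ℕ}
    (hm : 3 ≤ ε * m) (hk : (k : ℝ) < ε * m / 4 + 1) :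
    2⁻¹ ≤ (Measure.pi fun _ : Fin m => D) {y | k ≤ {i | y i ∈ E}.ncard} := by
  classical
  -- Replacing `E` by a measurable subset of the same measure can only lower the count.
  obtain ⟨E', hsub, hE', hae⟩ := hE.exists_measurable_subset_ae_eq
  set μ := Measure.pi fun _ : Fin m => D
  set p := D.real E' with hp
  have hpε : ε ≤ p := by
    rw [← measure_congr hae] at hDE
    rw [hp, measureReal_def]
    exact (ENNReal.ofReal_le_iff_le_toReal (measure_ne_top _ _)).1 hDE.le
  have hp1 : p ≤ 1 := measureReal_le_one
  -- A Chernoff bound: the product of the `g (y i)` is `2 ^ (-N)`, where `N` counts the sample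
  -- points in `E'`. Its mean is `(1 - p / 2) ^ m`, and Markov's inequality is applied at the level
  -- `a = 2 ^ (-ε m / 4)`.
  set g : X → ℝ := fun x => 1 - E'.indicator (fun _ => 1 / 2) x with hg
  have hgi : Integrable g D :=
    (integrable_const _).sub ((integrable_const _).indicator hE')
  have hgint : ∫ x, g x ∂D = 1 - p / 2 := by
    rw [hg, integral_sub (integrable_const _) ((integrable_const _).indicator hE'),
      integral_indicator_const _ hE']
    simp [hp, div_eq_mul_inv]
  set f : (Fin m → X) → ℝ := fun y => ∏ i, g (y i) with hf
  have hfi : Integrable f μ := Integrable.fintype_prod fun _ => hgi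
  have hfint : ∫ y, f y ∂μ = (1 - p / 2) ^ m := by
    rw [hf, integral_fintype_prod_eq_prod]
    simp [hgint]
  have hg0 : ∀ x, 0 ≤ g x := by
    intro x
    by_cases hx : x ∈ E' <;> simp [hg, hx]
    norm_num
  have hfc : ∀ y, f y = (1 / 2) ^ {i | y i ∈ E'}.ncard := by
    intro y
    have : ∀ i, g (y i) = if i ∈ Finset.univ.filter (fun i => y i ∈ E') then 1 / 2 else 1 := by
      intro i
      by_cases hx : y i ∈ E' <;> simp [hg, hx]
      norm_num
    simp only [hf, this, Finset.prod_ite_mem]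
    rw [Finset.prod_const, Finset.univ_inter, ← Set.ncard_coe_finset]
    simp
  set a := Real.exp (-(Real.log 2 * (ε * m / 4))) with ha
  have hmarkov : a * μ.real {y | a ≤ f y} ≤ (1 - p / 2) ^ m := by
    rw [← hfint]
    exact mul_meas_ge_le_integral_of_nonneg
      (Filter.Eventually.of_forall fun y => Finset.prod_nonneg fun i _ => hg0 _) hfi a
  have hcompl : {y : Fin m → X | k ≤ {i | y i ∈ E}.ncard}ᶜ ⊆ {y | a ≤ f y} := by
    intro y hy
    have hy : {i | y i ∈ E}.ncard < k := not_le.1 hy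
    have hle : {i | y i ∈ E'}.ncard ≤ {i | y i ∈ E}.ncard :=
      Set.ncard_le_ncard (fun i hi => hsub hi) (Set.toFinite _)
    have hc : ({i | y i ∈ E'}.ncard : ℝ) ≤ ε * m / 4 := by
      have : (({i | y i ∈ E'}.ncard : ℝ)) + 1 ≤ k := by exact_mod_cast hle.trans_lt hy
      linarith
    have h12 : ((1 / 2 : ℝ)) = Real.exp (-Real.log 2) := by
      rw [Real.exp_neg, Real.exp_log (by norm_num)]; norm_num
    rw [Set.mem_ofPred_eq, hfc, h12, ← Real.exp_nat_mul, ha, Real.exp_le_exp]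
    nlinarith [Real.log_pos (x := 2) (by norm_num)]
  have hexp : (1 - p / 2) ^ m ≤ Real.exp (-(ε * m / 2)) := by
    calc (1 - p / 2) ^ m ≤ Real.exp (-(p / 2)) ^ m :=
          pow_le_pow_left₀ (by linarith) (Real.one_sub_le_exp_neg _) m
      _ = Real.exp (m * (-(p / 2))) := (Real.exp_nat_mul _ m).symm
      _ ≤ _ := by
          refine Real.exp_le_exp.2 ?_
          have : (0 : ℝ) ≤ m := Nat.cast_nonneg m
          nlinarith
  have hhalf : μ.real {y | a ≤ f y} ≤ 1 / 2 := by
    have h1 : a * μ.real {y | a ≤ f y} ≤ a * (1 / 2) := by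
      refine (hmarkov.trans hexp).trans ?_
      have h12 : ((1 / 2 : ℝ)) = Real.exp (-Real.log 2) := by
        rw [Real.exp_neg, Real.exp_log (by norm_num)]; norm_num
      rw [h12, ha, ← Real.exp_add, Real.exp_le_exp]
      -- What is needed is `ε m (1/2 - log 2 / 4) ≥ log 2`, which holds because `ε m ≥ 3`.
      nlinarith [Real.log_two_lt_d9]
    exact le_of_mul_le_mul_left h1 (Real.exp_pos _)
  have h2 : μ {y | k ≤ {i | y i ∈ E}.ncard}ᶜ ≤ 2⁻¹ := by
    refine (measure_mono hcompl).trans ?_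
    rw [← ENNReal.ofReal_toReal (measure_ne_top μ _)]
    refine (ENNReal.ofReal_le_ofReal hhalf).trans_eq ?_
    rw [one_div, ENNReal.ofReal_inv_of_pos (by norm_num)]
    norm_num
  have h3 : 1 ≤ μ {y | k ≤ {i | y i ∈ E}.ncard} + 2⁻¹ := by
    calc (1 : ENNReal) = μ Set.univ := by simp
      _ ≤ μ {y | k ≤ {i | y i ∈ E}.ncard} + μ {y | k ≤ {i | y i ∈ E}.ncard}ᶜ := by
          rw [← Set.union_compl_self {y : Fin m → X | k ≤ {i | y i ∈ E}.ncard}]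
          exact measure_union_le _ _
      _ ≤ _ := by gcongr
  rw [← ENNReal.inv_two_add_inv_two] at h3
  exact (ENNReal.add_le_add_iff_right (by simp)).1 h3

/-- Symmetrization. -/
theorem measure_exists_le_two_mul (D : Measure X) [IsProbabilityMeasure D] {F : Set (Set X)}
    (hF : ∀ E ∈ F, NullMeasurableSet E D) {ε : ℝ} {m k : ℕ}
    (hm : 3 ≤ ε * m) (hk : (k : ℝ) < ε * m / 4 + 1) :
    (Measure.pi fun _ : Fin m => D) {x | ∃ E ∈ F, (∀ i, x i ∉ E) ∧ ENNReal.ofReal ε < D E} ≤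
      2 * ((Measure.pi fun _ : Fin m => D).prod (Measure.pi fun _ : Fin m => D))
        (doubleSampleEvent F m k) := by
  set μ := Measure.pi fun _ : Fin m => D
  -- The measurable hull has the same measure, so Fubini and Markov apply without measurability of
  -- the event. Every bad first sample has a fibre of measure at least one half.
  set Q := toMeasurable (μ.prod μ) (doubleSampleEvent F m k)
  have hQm : MeasurableSet Q := measurableSet_toMeasurable _ _
  have hsub : {x | ∃ E ∈ F, (∀ i, x i ∉ E) ∧ ENNReal.ofReal ε < D E} ⊆
      {x | 2⁻¹ ≤ μ (Prod.mk x ⁻¹' Q)} := by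
    rintro x ⟨E, hE, h0, hDE⟩
    refine (half_le_measure_le_ncard D (hF E hE) hDE hm hk).trans (measure_mono fun y hy => ?_)
    exact subset_toMeasurable _ _ ⟨E, hE, h0, hy⟩
  have h := mul_meas_ge_le_lintegral (μ := μ) (measurable_measure_prodMk_left (ν := μ) hQm) 2⁻¹
  rw [← Measure.prod_apply hQm, measure_toMeasurable] at h
  calc μ _ ≤ μ {x | 2⁻¹ ≤ μ (Prod.mk x ⁻¹' Q)} := measure_mono hsub
    _ = 2 * (2⁻¹ * μ {x | 2⁻¹ ≤ μ (Prod.mk x ⁻¹' Q)}) := by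
        rw [← mul_assoc, ENNReal.mul_inv_cancel (by simp) (by simp), one_mul]
    _ ≤ _ := by gcongr

/-- Sample complexity of consistent learning in terms of the Vapnik-Chervonenkis dimension. -/
theorem measure_exists_le_of_vcSampleSize_le (D : Measure X) [IsProbabilityMeasure D]
    {F : Set (Set X)} (hF : ∀ E ∈ F, NullMeasurableSet E D) {d : ℕ}
    (hd : ∀ A : Finset X, Shatters F A → A.card ≤ d) {m : ℕ}
    (hQ : ∀ k, NullMeasurableSet (doubleSampleEvent F m k)
      ((Measure.pi fun _ : Fin m => D).prod (Measure.pi fun _ : Fin m => D)))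
    {ε δ : ℝ} (hε : 0 < ε) (hε2 : ε < 1 / 2) (hδ : 0 < δ) (hδ2 : δ < 1 / 2)
    (hm : vcSampleSize 60 d ε δ ≤ m) :
    (Measure.pi fun _ : Fin m => D) {x | ∃ E ∈ F, (∀ i, x i ∉ E) ∧ ENNReal.ofReal ε < D E} ≤
      ENNReal.ofReal δ := by
  have hl2 := Real.log_two_gt_d9
  have hl2' := Real.log_two_lt_d9
  have hlε : Real.log 2 ≤ Real.log (1 / ε) :=
    Real.log_le_log (by norm_num) (by rw [le_div_iff₀ hε]; linarith)
  have hlδ : Real.log 2 ≤ Real.log (1 / δ) :=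
    Real.log_le_log (by norm_num) (by rw [le_div_iff₀ hδ]; linarith)
  set a := Real.log (1 / ε)
  set b := Real.log (1 / δ) with hb
  have hd0 : (0 : ℝ) ≤ d := Nat.cast_nonneg d
  have hm' : 60 * (d * a + b) ≤ ε * m := by
    rw [vcSampleSize, div_mul_eq_mul_div, div_le_iff₀ hε] at hm
    linarith
  have hda : 0 ≤ d * a := mul_nonneg hd0 (by linarith)
  have hm3 : 3 ≤ ε * m := by linarith
  set k := ⌈ε * m / 4⌉₊
  have hk1 : (k : ℝ) < ε * m / 4 + 1 := Nat.ceil_lt_add_one (by linarith)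
  have hk2 : ε * m / 4 ≤ k := Nat.le_ceil _
  refine (measure_exists_le_two_mul D hF hm3 hk1).trans ?_
  -- With `t = ε / 32` the growth factor `(1 + t) ^ (2 * m)` is at most `exp (ε m / 16)`, which the
  -- gain `2 ^ k ≥ exp (log 2 * ε m / 4)` outweighs.
  refine (mul_le_mul_right (measure_doubleSampleEvent_le D F d hd m k (hQ k)
    (t := ε / 32) (by positivity) (by linarith)) 2).trans ?_
  rw [show (2 : ENNReal) = ENNReal.ofReal 2 by norm_num, ← ENNReal.ofReal_mul (by norm_num)]
  refine ENNReal.ofReal_le_ofReal ?_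
  have e1 : (1 / (ε / 32)) ^ d = Real.exp (d * (5 * Real.log 2 + a)) := by
    rw [Real.exp_nat_mul]
    congr 1
    rw [Real.exp_add, Real.exp_log (by positivity), ← Real.log_rpow (by norm_num),
      Real.exp_log (by positivity)]
    norm_num
    field_simp
  have e2 : (1 + ε / 32) ^ (2 * m) ≤ Real.exp (ε * m / 16) := by
    calc (1 + ε / 32) ^ (2 * m) ≤ Real.exp (ε / 32) ^ (2 * m) :=
          pow_le_pow_left₀ (by positivity) (by linarith [Real.add_one_le_exp (ε / 32)]) _
      _ = Real.exp (ε * m / 16) := by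
          rw [← Real.exp_nat_mul]; congr 1; push_cast; ring
  have e3 : Real.exp (Real.log 2 * (ε * m / 4)) ≤ 2 ^ k := by
    calc Real.exp (Real.log 2 * (ε * m / 4)) ≤ Real.exp (k * Real.log 2) :=
          Real.exp_le_exp.2 (by nlinarith)
      _ = 2 ^ k := by rw [Real.exp_nat_mul, Real.exp_log (by norm_num)]
  have e4 : δ = Real.exp (-b) := by
    rw [hb, Real.exp_neg, Real.exp_log (by positivity), one_div, inv_inv]
  calc 2 * ((1 / (ε / 32)) ^ d * (1 + ε / 32) ^ (2 * m) / 2 ^ k)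
      ≤ Real.exp (Real.log 2) * (Real.exp (d * (5 * Real.log 2 + a)) * Real.exp (ε * m / 16) /
          Real.exp (Real.log 2 * (ε * m / 4))) := by
        rw [e1, Real.exp_log (by norm_num)]
        gcongr
    _ = Real.exp (Real.log 2 + (d * (5 * Real.log 2 + a) + ε * m / 16 -
          Real.log 2 * (ε * m / 4))) := by
        rw [Real.exp_add, Real.exp_sub, Real.exp_add]
    _ ≤ Real.exp (-b) := by
        -- Since `log 2 ≤ a` and `log 2 ≤ b`, it suffices that `(log 2 / 4 - 1 / 16) ε m ≥ 6 d a + 2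
        -- b`. The bracket exceeds `0.11`, so `ε m ≥ 60 (d a + b)` is enough; this is the origin of
        -- the constant `60`.
        refine Real.exp_le_exp.2 ?_
        have h1 : d * Real.log 2 ≤ d * a := mul_le_mul_of_nonneg_left hlε hd0
        nlinarith
    _ = δ := e4.symm

/-- Sample complexity of consistent learning for finite classes. -/
theorem measure_exists_le_of_finiteSampleSize_le (D : Measure X) [IsProbabilityMeasure D]
    {Y : Type*} {H : Set Y} (hH : H.Finite) (loss : Y → Set X)
    (hF : ∀ h ∈ H, NullMeasurableSet (loss h) D) {m : ℕ} {ε δ : ℝ} (hε : 0 < ε) (hε1 : ε < 1)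
    (hδ : 0 < δ) (hm : finiteSampleSize H.ncard ε δ ≤ m) :
    (Measure.pi fun _ : Fin m => D)
      {x | ∃ h ∈ H, (∀ i, x i ∉ loss h) ∧ ENNReal.ofReal ε < D (loss h)} ≤ ENNReal.ofReal δ := by
  set μ := Measure.pi fun _ : Fin m => D
  rcases H.eq_empty_or_nonempty with rfl | hne
  · simp
  have hN : (0 : ℝ) < H.ncard := by exact_mod_cast (Set.ncard_pos hH).2 hne
  have hone : ∀ h ∈ H, μ {x | (∀ i, x i ∉ loss h) ∧ ENNReal.ofReal ε < D (loss h)} ≤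
      ENNReal.ofReal (δ / H.ncard) := by
    intro h hh
    by_cases hlt : ENNReal.ofReal ε < D (loss h)
    swap
    · simp [hlt]
    have hset : {x : Fin m → X | (∀ i, x i ∉ loss h) ∧ ENNReal.ofReal ε < D (loss h)} =
        Set.univ.pi fun _ => (loss h)ᶜ := by
      ext x; simp [hlt, Set.mem_pi]
    rw [hset, Measure.pi_pi, Finset.prod_const, Finset.card_univ, Fintype.card_fin,
      prob_compl_eq_one_sub₀ (hF h hh)]
    calc (1 - D (loss h)) ^ m ≤ (ENNReal.ofReal (1 - ε)) ^ m := by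
          rw [ENNReal.ofReal_sub _ hε.le, ENNReal.ofReal_one]
          gcongr
      _ = ENNReal.ofReal ((1 - ε) ^ m) := (ENNReal.ofReal_pow (by linarith) m).symm
      _ ≤ _ := by
          refine ENNReal.ofReal_le_ofReal ?_
          have hm' : Real.log H.ncard + Real.log (1 / δ) ≤ ε * m := by
            rw [finiteSampleSize, div_mul_eq_mul_div, div_le_iff₀ hε] at hm
            linarith
          calc (1 - ε) ^ m ≤ Real.exp (-ε) ^ m :=
                pow_le_pow_left₀ (by linarith) (Real.one_sub_le_exp_neg _) m
            _ = Real.exp (m * (-ε)) := (Real.exp_nat_mul _ m).symm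
            _ ≤ Real.exp (-(Real.log H.ncard + Real.log (1 / δ))) :=
                Real.exp_le_exp.2 (by linarith)
            _ = δ / H.ncard := by
                rw [Real.exp_neg, Real.exp_add, Real.exp_log hN, Real.exp_log (by positivity)]
                field_simp
  have hU : {x : Fin m → X | ∃ h ∈ H, (∀ i, x i ∉ loss h) ∧ ENNReal.ofReal ε < D (loss h)} =
      ⋃ h ∈ hH.toFinset, {x | (∀ i, x i ∉ loss h) ∧ ENNReal.ofReal ε < D (loss h)} := by
    ext x; simp [and_left_comm]
  rw [hU]
  refine (measure_biUnion_finset_le _ _).trans ?_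
  refine (Finset.sum_le_sum fun h hh => hone h (hH.mem_toFinset.1 hh)).trans_eq ?_
  rw [Finset.sum_const, ← Set.ncard_eq_toFinset_card H hH, nsmul_eq_mul,
    ← ENNReal.ofReal_natCast, ← ENNReal.ofReal_mul hN.le, mul_div_cancel₀ _ hN.ne']

end DoubleSampling

/-! ### Robustly consistent learners -/

section RobustlyConsistent

variable {X : Type*} [PseudoMetricSpace X] [MeasurableSpace X] {ρ : ℝ} {C H : Set (X → Bool)}
  {L : LEQLearner X}

/-- For a fixed target the losses form a subclass of `lossClass ρ C H`, so they shatter no larger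
sets. Whatever the oracle does, an output of large risk is a hypothesis in `H` whose loss set has
large measure and misses the sample. -/
theorem RobustlyConsistent.robustlyLearns_vc (hL : RobustlyConsistent L ρ C H)
    (hW : WellBehaved ρ C H) (hvc : vcDim (lossClass ρ C H) ≠ ⊤) :
    RobustlyLearns L ρ C (vcSampleSize 60 (vcDim (lossClass ρ C H)).toNat) := by
  intro ε δ hε hε2 hδ hδ2 D _ c hc m hm
  refine ⟨fun x => (hL c hc m x).1, ?_⟩
  have key := measure_exists_le_of_vcSampleSize_le D (F := {E | ∃ h ∈ H, E = robustLoss ρ c h})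
    (by rintro _ ⟨h, hh, rfl⟩; exact hW.1 c hc h hh D)
    (d := (vcDim (lossClass ρ C H)).toNat)
    (fun A hA => Shatters.card_le_vcDim_toNat hvc fun T =>
      let ⟨E, ⟨h, hh, hE⟩, hT⟩ := hA T
      ⟨E, ⟨c, hc, h, hh, hE⟩, hT⟩)
    (m := m)
    (fun k => by
      convert hW.2 c hc D m k using 1
      ext p
      simp [doubleSampleEvent]) hε hε2 hδ hδ2 hm
  refine (measure_mono ?_).trans key
  rintro x ⟨h, ho, hr⟩
  obtain ⟨hh, h0⟩ := (hL c hc m x).2 h ho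
  exact ⟨_, ⟨h, hh, rfl⟩, h0, hr⟩

theorem RobustlyConsistent.robustlyLearns_finite (hL : RobustlyConsistent L ρ C H)
    (hH : H.Finite) (hM : MeasurableLosses ρ C H) :
    RobustlyLearns L ρ C (finiteSampleSize H.ncard) := by
  intro ε δ hε hε2 hδ _ D _ c hc m hm
  refine ⟨fun x => (hL c hc m x).1, ?_⟩
  refine (measure_mono ?_).trans (measure_exists_le_of_finiteSampleSize_le D hH (robustLoss ρ c)
    (fun h hh => hM c hc h hh D) hε (by linarith) hδ hm)
  rintro x ⟨h, ho, hr⟩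
  obtain ⟨hh, h0⟩ := (hL c hc m x).2 h ho
  exact ⟨h, hh, h0, hr⟩

end RobustlyConsistent

end RobustLEQ

theorem mainTheorem10 :
    ∃ κ : ℝ, 0 < κ ∧
      ∀ (X : Type*) [PseudoMetricSpace X] [MeasurableSpace X] (ρ : ℝ) (C : Set (X → Bool)),
        0 ≤ ρ →
        -- robustly consistent learners
        (∀ (H : Set (X → Bool)) (L : RobustLEQ.LEQLearner X),
          RobustLEQ.RobustlyConsistent L ρ C H →
            (RobustLEQ.WellBehaved ρ C H →
              RobustLEQ.vcDim (RobustLEQ.lossClass ρ C H) ≠ ⊤ →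
              RobustLEQ.RobustlyLearns L ρ C
                (RobustLEQ.vcSampleSize κ
                  (RobustLEQ.vcDim (RobustLEQ.lossClass ρ C H)).toNat)) ∧
            (H.Finite → RobustLEQ.MeasurableLosses ρ C H →
              RobustLEQ.RobustlyLearns L ρ C (RobustLEQ.finiteSampleSize H.ncard))) ∧
        -- the Standard Optimal Algorithm, with an output in `C`
        (∀ (A : RobustLEQ.OnlineLearner X) (L : RobustLEQ.LEQLearner X),
          RobustLEQ.IsSOA C A →
          L = RobustLEQ.onlineLEQ A (RobustLEQ.litDim C).toNat (RobustLEQ.properOutput ρ C) →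
            (RobustLEQ.litDim C ≠ ⊤ →
              RobustLEQ.RobustlyConsistent L ρ C C ∧
              RobustLEQ.QueryBound L ρ C (fun m => m * RobustLEQ.litDim C) ∧
              (RobustLEQ.WellBehaved ρ C C →
                RobustLEQ.vcDim (RobustLEQ.lossClass ρ C C) ≠ ⊤ →
                RobustLEQ.RobustlyLearns L ρ C
                  (RobustLEQ.vcSampleSize κ
                    (RobustLEQ.vcDim (RobustLEQ.lossClass ρ C C)).toNat))) ∧
            (C.Finite →
              RobustLEQ.RobustlyConsistent L ρ C C ∧
              RobustLEQ.QueryBound L ρ C (fun m => m * RobustLEQ.litDim C) ∧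
              (RobustLEQ.MeasurableLosses ρ C C →
                RobustLEQ.RobustlyLearns L ρ C (RobustLEQ.finiteSampleSize C.ncard)))) ∧
        -- the Standard Optimal Algorithm, with its own final hypothesis as output
        (∀ (A : RobustLEQ.OnlineLearner X) (H : Set (X → Bool)) (L : RobustLEQ.LEQLearner X),
          RobustLEQ.IsSOA C A → RobustLEQ.UsesHypotheses A C H → RobustLEQ.litDim C ≠ ⊤ →
          L = RobustLEQ.onlineLEQ A (RobustLEQ.litDim C).toNat RobustLEQ.plainOutput →
            RobustLEQ.RobustlyConsistent L ρ C H ∧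
            RobustLEQ.QueryBound L ρ C (fun m => m * RobustLEQ.litDim C) ∧
            (RobustLEQ.WellBehaved ρ C H →
              RobustLEQ.vcDim (RobustLEQ.lossClass ρ C H) ≠ ⊤ →
              RobustLEQ.RobustlyLearns L ρ C
                (RobustLEQ.vcSampleSize κ
                  (RobustLEQ.vcDim (RobustLEQ.lossClass ρ C H)).toNat)) ∧
            (H.Finite → RobustLEQ.MeasurableLosses ρ C H →
              RobustLEQ.RobustlyLearns L ρ C (RobustLEQ.finiteSampleSize H.ncard))) ∧
        -- an arbitrary online learner with a mistake bound, with its final hypothesis as output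
        (∀ (A : RobustLEQ.OnlineLearner X) (M : ℕ) (H : Set (X → Bool))
            (L : RobustLEQ.LEQLearner X),
          RobustLEQ.HasMistakeBound A C M → RobustLEQ.UsesHypotheses A C H →
          L = RobustLEQ.onlineLEQ A M RobustLEQ.plainOutput →
            RobustLEQ.RobustlyConsistent L ρ C H ∧
            RobustLEQ.QueryBound L ρ C (fun m => m * M) ∧
            (RobustLEQ.WellBehaved ρ C H →
              RobustLEQ.vcDim (RobustLEQ.lossClass ρ C H) ≠ ⊤ →
              RobustLEQ.RobustlyLearns L ρ C
                (RobustLEQ.vcSampleSize κ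
                  (RobustLEQ.vcDim (RobustLEQ.lossClass ρ C H)).toNat)) ∧
            (H.Finite → RobustLEQ.MeasurableLosses ρ C H →
              RobustLEQ.RobustlyLearns L ρ C (RobustLEQ.finiteSampleSize H.ncard))) ∧
        -- an arbitrary online learner with a mistake bound, with an output in `C`
        (∀ (A : RobustLEQ.OnlineLearner X) (M : ℕ) (L : RobustLEQ.LEQLearner X),
          RobustLEQ.HasMistakeBound A C M →
          L = RobustLEQ.onlineLEQ A M (RobustLEQ.properOutput ρ C) →
            RobustLEQ.RobustlyConsistent L ρ C C ∧
            RobustLEQ.QueryBound L ρ C (fun m => m * M) ∧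
            (RobustLEQ.WellBehaved ρ C C →
              RobustLEQ.vcDim (RobustLEQ.lossClass ρ C C) ≠ ⊤ →
              RobustLEQ.RobustlyLearns L ρ C
                (RobustLEQ.vcSampleSize κ
                  (RobustLEQ.vcDim (RobustLEQ.lossClass ρ C C)).toNat)) ∧
            (C.Finite → RobustLEQ.MeasurableLosses ρ C C →
              RobustLEQ.RobustlyLearns L ρ C (RobustLEQ.finiteSampleSize C.ncard))) := by
  refine ⟨60, by norm_num, ?_⟩
  intro X _ _ ρ C _
  refine ⟨fun H L hL => ⟨hL.robustlyLearns_vc, hL.robustlyLearns_finite⟩, ?_, ?_, ?_, ?_⟩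
  · rintro A L hA rfl
    have main := fun hC : RobustLEQ.litDim C ≠ ⊤ =>
      (hA.hasMistakeBound hC).robustlyConsistent_properOutput (ρ := ρ)
    refine ⟨fun hC => ⟨main hC, RobustLEQ.queryBound_onlineLEQ_litDim hC,
      (main hC).robustlyLearns_vc⟩, fun hf => ?_⟩
    have hC := RobustLEQ.litDim_ne_top_of_finite hf
    exact ⟨main hC, RobustLEQ.queryBound_onlineLEQ_litDim hC, (main hC).robustlyLearns_finite hf⟩
  · rintro A H L hA hH hC rfl
    have main := (hA.hasMistakeBound hC).robustlyConsistent_plainOutput (ρ := ρ) hH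
    exact ⟨main, RobustLEQ.queryBound_onlineLEQ_litDim hC, main.robustlyLearns_vc,
      main.robustlyLearns_finite⟩
  · rintro A M H L hA hH rfl
    have main := hA.robustlyConsistent_plainOutput (ρ := ρ) hH
    exact ⟨main, by exact_mod_cast RobustLEQ.queryBound_onlineLEQ, main.robustlyLearns_vc,
      main.robustlyLearns_finite⟩
  · rintro A M L hA rfl
    have main := hA.robustlyConsistent_properOutput (ρ := ρ)
    exact ⟨main, by exact_mod_cast RobustLEQ.queryBound_onlineLEQ, main.robustlyLearns_vc,
      main.robustlyLearns_finite⟩
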